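/- All Banach spaces are real, and "subspace" means closed linear subspace. A Banach space $Y$ is *almost square* if for every $\varepsilon>0$ and every finite subset $\{y_1,\dots,y_N\}$ of the unit sphere $S_Y$ there is $y\in S_Y$ with $\|y_n-y\|\le 1+\varepsilon$ for all $n$ (the empty set is allowed, so $\{0\}$ is not almost square). A subspace $X$ of $Y$ is an *almost isometric ideal* (ai-ideal) in $Y$ if for every $\varepsilon>0$ and every finite-dimensional subspace $E$ of $Y$ there is a linear operator $T:E\to X$ such that $Te=e$ for all $e\in E\cap X$ and $(1-\varepsilon)\|e\|\le\|Te\|\le(1+\varepsilon)\|e\|$ for all $e\in E$. A Banach space *contains a copy of* $c_0$ if it has a subspace linearly homeomorphic to $c_0$, the space of real null sequences with the supremum norm. **Theorem.** Let $Y$ be a Banach space. The following statements are equivalent: (a) $Y$ is almost square. (b) Every separable ai-ideal in $Y$ is almost square. (c) Every subspace $X$ of $Y$ such that $Y/X$ does not contain a copy of $c_0$ is almost square. (d) Every subspace of finite codimension in $Y$ is almost square. -/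

import Mathlib

open scoped ZeroAtInfty

/-- A normed space `Y` is almost square if for every `ε > 0` and every finite subset `s` of its
unit sphere there is a unit vector `y` with `‖x - y‖ ≤ 1 + ε` for every `x ∈ s`. -/
def IsAlmostSquare (Y : Type*) [NormedAddCommGroup Y] [NormedSpace ℝ Y] : Prop :=
  ∀ ε : ℝ, 0 < ε → ∀ s : Finset Y, (∀ x ∈ s, ‖x‖ = 1) →
    ∃ y : Y, ‖y‖ = 1 ∧ ∀ x ∈ s, ‖x - y‖ ≤ 1 + ε

/-- `X` is an almost isometric ideal in `Y`: every finite-dimensional subspace `E` of `Y` can,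
for every `ε > 0`, be mapped into `X` by a linear `(1 ± ε)`-isometry fixing `E ∩ X` pointwise. -/
def IsAIIdeal {Y : Type*} [NormedAddCommGroup Y] [NormedSpace ℝ Y] (X : Submodule ℝ Y) : Prop :=
  ∀ ε : ℝ, 0 < ε → ∀ E : Submodule ℝ Y, FiniteDimensional ℝ E →
    ∃ T : E →ₗ[ℝ] X,
      (∀ e : E, (e : Y) ∈ X → ((T e : X) : Y) = e) ∧
      ∀ e : E, (1 - ε) * ‖e‖ ≤ ‖T e‖ ∧ ‖T e‖ ≤ (1 + ε) * ‖e‖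

/-- `Z` contains a copy of `c₀`: some linear subspace of `Z` is linearly homeomorphic to `c₀`, the
space `C₀(ℕ, ℝ)` of real null sequences with the supremum norm. -/
def ContainsCopyOfCZero (Z : Type*) [SeminormedAddCommGroup Z] [NormedSpace ℝ Z] : Prop :=
  ∃ W : Submodule ℝ Z, Nonempty (C₀(ℕ, ℝ) ≃L[ℝ] W)

/-!
If `Y` is almost square and `X` is an ai-ideal, an almost isometric map into `X` fixing finitely
many given unit vectors of `X` carries a witness from `Y` into `X`. Conversely, the norm profiles
of finite tuples live in separable spaces of continuous functions, so a separable subspace can be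
closed off, as in the Sims–Yost theorem, under replacing the vectors of a tuple outside it by
vectors inside with almost the same profile. The result is a separable ai-ideal, so finite sets can
be handled there.

In an almost square space one chooses unit vectors `y 0, y 1, …` one at a time, each a witness for
the given finite set and for the normalizations of all signed sums `±y 0 ± ⋯ ± y (n - 1)`. The
signed sums then stay bounded, so `∑ y n` is weakly unconditionally Cauchy, and so is its image in
`Y ⧸ X`. If the images were bounded away from zero, Rosenthal's disjointification would extract a
subsequence equivalent to the basis of `c₀` (Bessaga–Pełczyński). If `Y ⧸ X` contains no copy of
`c₀`, some `y n` is therefore almost in `X`, and a vector of `X` near it is the required witness.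
-/

open Filter Topology TopologicalSpace
open scoped NNReal Pointwise

section Witnesses

variable {Y : Type*} [NormedAddCommGroup Y] [NormedSpace ℝ Y]

theorem norm_sub_normalize {y : Y} (hy : y ≠ 0) : ‖y - NormedSpace.normalize y‖ = |‖y‖ - 1| := by
  calc ‖y - NormedSpace.normalize y‖
      = ‖(‖y‖ - 1) • NormedSpace.normalize y‖ := by
        rw [sub_smul, one_smul, NormedSpace.norm_smul_normalize]
    _ = |‖y‖ - 1| := by
        rw [norm_smul, NormedSpace.norm_normalize_eq_one_iff.2 hy, mul_one, Real.norm_eq_abs]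

theorem IsAlmostSquare.of_forall_exists_abs_norm_sub_one_le
    (h : ∀ ε : ℝ, 0 < ε → ∀ s : Finset Y, (∀ x ∈ s, ‖x‖ = 1) →
      ∃ y : Y, |‖y‖ - 1| ≤ ε ∧ ∀ x ∈ s, ‖x - y‖ ≤ 1 + ε) : IsAlmostSquare Y := by
  intro ε hε s hs
  obtain ⟨y, hy, hys⟩ := h (min (ε / 2) (1 / 2)) (by positivity) s hs
  obtain ⟨hyε, hy2⟩ := le_min_iff.1 hy
  have hy0 : y ≠ 0 := by
    rintro rfl
    norm_num at hy2
  refine ⟨NormedSpace.normalize y, NormedSpace.norm_normalize_eq_one_iff.2 hy0, fun x hx ↦ ?_⟩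
  calc ‖x - NormedSpace.normalize y‖
      ≤ ‖x - y‖ + ‖y - NormedSpace.normalize y‖ := norm_sub_le_norm_sub_add_norm_sub ..
    _ ≤ (1 + ε / 2) + ε / 2 := by
        rw [norm_sub_normalize hy0]
        gcongr
        exact (hys x hx).trans (by gcongr; exact min_le_left _ _)
    _ = 1 + ε := by ring

theorem IsAlmostSquare.of_forall_finset_subset_submodule
    (h : ∀ s : Finset Y, ∃ X : Submodule ℝ Y, (s : Set Y) ⊆ X ∧ IsAlmostSquare X) :
    IsAlmostSquare Y := by
  classical
  intro ε hε s hs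
  obtain ⟨X, hsX, hX⟩ := h s
  obtain ⟨y, hy, hys⟩ := hX ε hε (s.subtype (· ∈ X)) fun x hx ↦ hs x (Finset.mem_subtype.1 hx)
  exact ⟨y, hy, fun x hx ↦ hys ⟨x, hsX hx⟩ (Finset.mem_subtype.2 hx)⟩

theorem IsAlmostSquare.of_isAIIdeal (hY : IsAlmostSquare Y) {X : Submodule ℝ Y}
    (hX : IsAIIdeal X) : IsAlmostSquare X := by
  classical
  refine .of_forall_exists_abs_norm_sub_one_le fun ε hε s hs ↦ ?_
  obtain ⟨η, hη, hη1, hηε⟩ : ∃ η : ℝ, 0 < η ∧ η ≤ 1 ∧ η ≤ ε / 3 :=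
    ⟨min 1 (ε / 3), by positivity, min_le_left _ _, min_le_right _ _⟩
  obtain ⟨y, hy, hys⟩ := hY η hη (s.image (↑)) (by simpa using hs)
  let E : Submodule ℝ Y := Submodule.span ℝ (insert y (s.image (↑)) : Finset Y)
  have hyE : y ∈ E := Submodule.subset_span (by simp)
  have hsE (x) (hx : x ∈ s) : (x : Y) ∈ E := Submodule.subset_span (by simpa using .inr hx)
  obtain ⟨T, hTX, hT⟩ := hX η hη E inferInstance
  refine ⟨T ⟨y, hyE⟩, ?_, fun x hx ↦ ?_⟩
  · obtain ⟨hlow, hup⟩ := hT ⟨y, hyE⟩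
    rw [show ‖(⟨y, hyE⟩ : E)‖ = 1 from hy] at hlow hup
    exact abs_le.2 ⟨by linarith, by linarith⟩
  · have hTx : T ⟨x, hsE x hx⟩ = x := Subtype.ext (hTX ⟨x, hsE x hx⟩ x.2)
    calc ‖x - T ⟨y, hyE⟩‖ = ‖T (⟨x, hsE x hx⟩ - ⟨y, hyE⟩)‖ := by rw [map_sub, hTx]
      _ ≤ (1 + η) * ‖(x : Y) - y‖ := (hT _).2
      _ ≤ (1 + η) * (1 + η) := by gcongr; exact hys x (Finset.mem_image_of_mem _ hx)
      _ ≤ 1 + ε := by nlinarith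

end Witnesses

section Reflection

variable {Y : Type*} [SeminormedAddCommGroup Y] [NormedSpace ℝ Y]
  {ι κ : Type*} [Fintype ι] [Fintype κ]

/-- The norms of the linear combinations of a tuple of vectors, as a function of the coefficients.
By homogeneity it is enough to record coefficients in the unit ball, and these form a compact set,
so that the possible profiles live in a separable space. -/
def normProfile (u : ι → Y) : C(Metric.closedBall (0 : ι → ℝ) 1, ℝ) where
  toFun c := ‖∑ i, c.1 i • u i‖
  continuous_toFun := by
    refine continuous_norm.comp (continuous_finsetSum _ fun i _ ↦ ?_)
    exact ((continuous_apply i).comp continuous_subtype_val).smul continuous_const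

theorem abs_norm_sum_smul_sub_norm_sum_smul_le (u v : ι → Y) (c : ι → ℝ) :
    |‖∑ i, c i • u i‖ - ‖∑ i, c i • v i‖| ≤ dist (normProfile u) (normProfile v) * ‖c‖ := by
  rcases eq_or_ne c 0 with rfl | hc
  · simp
  have hmem : NormedSpace.normalize c ∈ Metric.closedBall 0 1 :=
    mem_closedBall_zero_iff.2 (NormedSpace.norm_normalize_eq_one_iff.2 hc).le
  have hscale (w : ι → Y) : ‖∑ i, c i • w i‖ = ‖c‖ * normProfile w ⟨_, hmem⟩ := by
    conv_lhs => rw [← NormedSpace.norm_smul_normalize c]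
    simp only [Pi.smul_apply, smul_assoc, ← Finset.smul_sum, norm_smul, norm_norm]
    rfl
  rw [hscale, hscale, ← mul_sub, abs_mul, abs_norm, mul_comm]
  gcongr
  exact ContinuousMap.dist_apply_le_dist (f := normProfile u) (g := normProfile v) ⟨_, hmem⟩

theorem lipschitzWith_normProfile :
    LipschitzWith (Fintype.card ι) (normProfile (ι := ι) (Y := Y)) := by
  refine LipschitzWith.of_dist_le_mul fun u v ↦ ?_
  refine (ContinuousMap.dist_le (by positivity)).2 fun c ↦ ?_
  have hc (i) : |c.1 i| ≤ 1 := (norm_le_pi_norm c.1 i).trans (mem_closedBall_zero_iff.1 c.2)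
  calc |‖∑ i, c.1 i • u i‖ - ‖∑ i, c.1 i • v i‖|
      ≤ ‖∑ i, c.1 i • (u i - v i)‖ := by
        simpa only [smul_sub, Finset.sum_sub_distrib] using abs_norm_sub_norm_le _ _
    _ ≤ ∑ i, |c.1 i| * dist (u i) (v i) :=
        norm_sum_le_of_le _ fun i _ ↦ by rw [norm_smul, Real.norm_eq_abs, dist_eq_norm]
    _ ≤ ∑ _i : ι, 1 * dist u v := by
        gcongr with i
        exacts [hc i, dist_le_pi_dist u v i]
    _ = _ := by simp

theorem exists_countable_dense_normProfile (f : ι → Y) :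
    ∃ D : Set (κ → Y), D.Countable ∧ ∀ (g : κ → Y) (δ : ℝ), 0 < δ →
      ∃ d ∈ D, dist (normProfile (Sum.elim f g)) (normProfile (Sum.elim f d)) < δ := by
  let Φ (g : κ → Y) := normProfile (Sum.elim f g)
  obtain ⟨t, htΦ, htc, hdense⟩ :=
    (IsSeparable.of_separableSpace (Set.range Φ)).exists_countable_dense_subset
  choose! G hG using fun p (hp : p ∈ t) ↦ htΦ hp
  refine ⟨G '' t, htc.image G, fun g δ hδ ↦ ?_⟩
  obtain ⟨p, hp, hgp⟩ := Metric.mem_closure_iff.1 (hdense ⟨g, rfl⟩) δ hδ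
  exact ⟨G p, ⟨p, hp, rfl⟩, by rwa [show normProfile _ = p from hG p hp]⟩

/-- Every finite tuple `g` of vectors can be replaced by a tuple in `X` at the cost of a small
change in the norms of its linear combinations with a given finite tuple `f` in `S`. The case
`S = X` makes `X` an almost isometric ideal; distinct sets allow `X` to be built in stages. -/
def Reflects (S X : Set Y) : Prop :=
  ∀ (m k : ℕ) (f : Fin m → Y), (∀ i, f i ∈ S) → ∀ (g : Fin k → Y) (δ : ℝ), 0 < δ →
    ∃ d : Fin k → Y, (∀ j, d j ∈ X) ∧
      dist (normProfile (Sum.elim f g)) (normProfile (Sum.elim f d)) < δ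

theorem Reflects.mono {S S' X X' : Set Y} (h : Reflects S X) (hS : S' ⊆ S) (hX : X ⊆ X') :
    Reflects S' X' := fun m k f hf g δ hδ ↦
  let ⟨d, hd, hgd⟩ := h m k f (fun i ↦ hS (hf i)) g δ hδ
  ⟨d, fun j ↦ hX (hd j), hgd⟩

theorem Reflects.closure_left {S X : Set Y} (h : Reflects S X) : Reflects (closure S) X := by
  intro m k f hf g δ hδ
  obtain ⟨η, hη, hηδ⟩ := Metric.uniformContinuous_iff.1
    (lipschitzWith_normProfile (Y := Y) (ι := Fin m ⊕ Fin k)).uniformContinuous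
    (δ / 3) (by positivity)
  choose f' hf'S hff' using fun i ↦ Metric.mem_closure_iff.1 (hf i) η hη
  have hclose (e : Fin k → Y) :
      dist (normProfile (Sum.elim f e)) (normProfile (Sum.elim f' e)) < δ / 3 := by
    refine hηδ ((dist_pi_lt_iff hη).2 ?_)
    rintro (i | j)
    · exact hff' i
    · simpa using hη
  obtain ⟨d, hdX, hgd⟩ := h m k f' hf'S g (δ / 3) (by positivity)
  refine ⟨d, hdX, ?_⟩
  calc dist (normProfile (Sum.elim f g)) (normProfile (Sum.elim f d))
      ≤ dist (normProfile (Sum.elim f g)) (normProfile (Sum.elim f' g)) +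
          dist (normProfile (Sum.elim f' g)) (normProfile (Sum.elim f' d)) +
          dist (normProfile (Sum.elim f' d)) (normProfile (Sum.elim f d)) := dist_triangle4 ..
    _ < δ / 3 + δ / 3 + δ / 3 := by
        rw [dist_comm (normProfile (Sum.elim f' d))]
        gcongr
        exacts [hclose g, hclose d]
    _ = δ := add_thirds δ

theorem Reflects.iUnion_of_monotone {V : ℕ → Set Y} (hV : Monotone V)
    (h : ∀ n, Reflects (V n) (V (n + 1))) : Reflects (⋃ n, V n) (⋃ n, V n) := by
  intro m k f hf g δ hδ
  choose a ha using fun i ↦ Set.mem_iUnion.1 (hf i)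
  have hf' (i) : f i ∈ V (Finset.univ.sup a) := hV (Finset.le_sup (Finset.mem_univ i)) (ha i)
  exact (h _).mono le_rfl (Set.subset_iUnion V _) m k f hf' g δ hδ

theorem exists_countable_reflects {A : Set Y} (hA : A.Countable) :
    ∃ B : Set Y, B.Countable ∧ Reflects A B := by
  choose D hDc hD using fun (m k : ℕ) (f : Fin m → Y) ↦
    exists_countable_dense_normProfile (κ := Fin k) f
  refine ⟨⋃ m, ⋃ k, ⋃ f ∈ {f : Fin m → Y | ∀ i, f i ∈ A}, ⋃ d ∈ D m k f, Set.range d, ?_, ?_⟩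
  · exact Set.countable_iUnion fun m ↦ Set.countable_iUnion fun k ↦
      (Set.countable_pi fun _ ↦ hA).biUnion fun f _ ↦
        (hDc m k f).biUnion fun d _ ↦ Set.countable_range d
  · intro m k f hf g δ hδ
    obtain ⟨d, hdD, hgd⟩ := hD m k f g δ hδ
    refine ⟨d, fun j ↦ ?_, hgd⟩
    simp only [Set.mem_iUnion]
    exact ⟨m, k, f, hf, d, hdD, j, rfl⟩

theorem exists_isSeparable_reflects (S : Submodule ℝ Y) (hS : IsSeparable (S : Set Y)) :
    ∃ X : Submodule ℝ Y, S ≤ X ∧ IsSeparable (X : Set Y) ∧ Reflects (S : Set Y) X := by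
  obtain ⟨A, -, hA, hSA⟩ := hS.exists_countable_dense_subset
  obtain ⟨B, hB, hAB⟩ := exists_countable_reflects hA
  refine ⟨Submodule.span ℝ (S ∪ B), fun x hx ↦ Submodule.subset_span (.inl hx),
    (hS.union hB.isSeparable).span, hAB.closure_left.mono hSA fun x hx ↦ ?_⟩
  exact Submodule.subset_span (.inr hx)

theorem exists_isSeparable_isClosed_reflects_self (S : Submodule ℝ Y)
    (hS : IsSeparable (S : Set Y)) :
    ∃ X : Submodule ℝ Y, S ≤ X ∧ IsClosed (X : Set Y) ∧ IsSeparable (X : Set Y) ∧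
      Reflects (X : Set Y) X := by
  choose F hle hsep hF using
    fun S : {S : Submodule ℝ Y // IsSeparable (S : Set Y)} ↦ exists_isSeparable_reflects S.1 S.2
  let V (n : ℕ) : {S : Submodule ℝ Y // IsSeparable (S : Set Y)} :=
    (fun W ↦ ⟨F W, hsep W⟩)^[n] ⟨S, hS⟩
  have hVsucc (n : ℕ) : (V (n + 1)).1 = F (V n) := by
    simp only [V, Function.iterate_succ_apply']
  have hmono : Monotone fun n ↦ (V n).1 :=
    monotone_nat_of_le_succ fun n ↦ (hle (V n)).trans_eq (hVsucc n).symm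
  let U : Submodule ℝ Y := ⨆ n, (V n).1
  have hU : (U : Set Y) = ⋃ n, ((V n).1 : Set Y) :=
    Submodule.coe_iSup_of_directed _ hmono.directed_le
  have hUrefl : Reflects (U : Set Y) U := by
    rw [hU]
    exact .iUnion_of_monotone hmono fun n ↦ by simpa only [hVsucc] using hF (V n)
  refine ⟨U.topologicalClosure, (le_iSup (fun n ↦ (V n).1) 0).trans U.le_topologicalClosure,
    U.isClosed_topologicalClosure, ?_, hUrefl.closure_left.mono le_rfl subset_closure⟩
  rw [Submodule.topologicalClosure_coe, hU]
  exact (isSeparable_iUnion.2 fun n ↦ (V n).2).closure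

end Reflection

section AlmostIsometricIdeals

variable {Y : Type*} [NormedAddCommGroup Y] [NormedSpace ℝ Y]

theorem abs_norm_sub_norm_constr_le {ι : Type*} [Fintype ι] {E X : Submodule ℝ Y}
    (b : Module.Basis ι ℝ E) (v : ι → X) (e : E) :
    |‖e‖ - ‖b.constr ℝ v e‖| ≤
      dist (normProfile fun i ↦ (b i : Y)) (normProfile fun i ↦ (v i : Y)) *
        (‖b.equivFunL.toContinuousLinearMap‖ * ‖e‖) := by
  have he : ∑ i, b.equivFun e i • (b i : Y) = e := by
    conv_rhs => rw [← b.sum_equivFun e, Submodule.coe_sum]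
    rfl
  have hv : ∑ i, b.equivFun e i • (v i : Y) = (b.constr ℝ v e : X) := by
    rw [b.constr_apply_fintype ℝ, Submodule.coe_sum]
    rfl
  rw [Submodule.coe_norm, Submodule.coe_norm, ← hv]
  conv_lhs => enter [1, 1]; rw [← he]
  refine (abs_norm_sum_smul_sub_norm_sum_smul_le _ _ _).trans ?_
  gcongr
  exact b.equivFunL.toContinuousLinearMap.le_opNorm e

theorem Reflects.isAIIdeal {X : Submodule ℝ Y} (h : Reflects (X : Set Y) X) : IsAIIdeal X := by
  intro ε hε E hE
  let P : Submodule ℝ E := X.comap E.subtype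
  let p := Module.finBasis ℝ P
  let b := p.sumQuot (Module.finBasis ℝ (E ⧸ P))
  have hb (i) : b (.inl i) = p i := p.sumQuot_inl _ i
  let f (i) : X := ⟨p i, (p i).2⟩
  let K := ‖b.equivFunL.toContinuousLinearMap‖
  have hK : 0 < K + 1 := by positivity
  obtain ⟨d, hdX, hd⟩ := h _ _ (fun i ↦ f i) (fun i ↦ (f i).2) (fun j ↦ b (.inr j))
    (ε / (K + 1)) (by positivity)
  let v := Sum.elim f fun j ↦ (⟨d j, hdX j⟩ : X)
  have hbv : dist (normProfile fun i ↦ (b i : Y)) (normProfile fun i ↦ (v i : Y)) <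
      ε / (K + 1) := by
    convert hd using 3 <;> ext (i | j) <;> simp [v, f, hb]
  refine ⟨b.constr ℝ v, fun e he ↦ ?_, fun e ↦ ?_⟩
  · have hP : X.subtype ∘ₗ b.constr ℝ v ∘ₗ P.subtype = E.subtype ∘ₗ P.subtype := p.ext fun i ↦ by
      simp [v, f, ← hb]
    exact LinearMap.congr_fun hP ⟨e, he⟩
  · have hclose : |‖e‖ - ‖b.constr ℝ v e‖| ≤ ε * ‖e‖ := by
      calc |‖e‖ - ‖b.constr ℝ v e‖| ≤ ε / (K + 1) * (K * ‖e‖) :=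
            (abs_norm_sub_norm_constr_le b v e).trans (by gcongr)
        _ ≤ ε / (K + 1) * ((K + 1) * ‖e‖) := by gcongr; linarith
        _ = ε * ‖e‖ := by rw [← mul_assoc, div_mul_cancel₀ _ hK.ne']
    obtain ⟨hlow, hup⟩ := abs_le.1 hclose
    constructor <;> linarith

theorem exists_isSeparable_isAIIdeal (S : Submodule ℝ Y) (hS : IsSeparable (S : Set Y)) :
    ∃ X : Submodule ℝ Y, S ≤ X ∧ IsClosed (X : Set Y) ∧ IsSeparable (X : Set Y) ∧
      IsAIIdeal X :=
  let ⟨X, hSX, hcl, hsep, hX⟩ := exists_isSeparable_isClosed_reflects_self S hS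
  ⟨X, hSX, hcl, hsep, hX.isAIIdeal⟩

end AlmostIsometricIdeals

section Disjointification

variable {ι : Type*}

/-- The sums of the off-diagonal entries of each row of the matrix `μ` are at most `C`, which is
the quantity that Rosenthal's disjointification reduces. For a nonnegative matrix, finite sums
encode this without summability assumptions. -/
def OffDiagSumLE (C : ℝ) (μ : ι → ι → ℝ) : Prop :=
  ∀ (n : ι) (F : Finset ι), n ∉ F → ∑ k ∈ F, μ n k ≤ C

-- Cut `ℕ` into infinitely many infinite columns. Either some column has small off-diagonal sums, or
-- every column `p` has a row with sum above `ε` inside the column; picking these rows leaves at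
-- most `C - ε` for the entries of the row `p` in the other columns.
theorem OffDiagSumLE.exists_embedding_or_sub {C : ℝ} {μ : ℕ → ℕ → ℝ} (hμ : OffDiagSumLE C μ)
    (ε : ℝ) :
    ∃ m : ℕ ↪ ℕ, OffDiagSumLE ε (fun n k ↦ μ (m n) (m k)) ∨
      OffDiagSumLE (C - ε) (fun n k ↦ μ (m n) (m k)) := by
  classical
  let column (p : ℕ) : ℕ ↪ ℕ := ⟨Nat.pair p, fun _ _ h ↦ (Nat.pair_eq_pair.1 h).2⟩
  by_cases h : ∃ p, OffDiagSumLE ε fun n k ↦ μ (column p n) (column p k)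
  · obtain ⟨p, hp⟩ := h
    exact ⟨column p, .inl hp⟩
  simp only [OffDiagSumLE, not_exists, not_forall, not_le] at h
  choose ν F hνF hF using h
  let m : ℕ ↪ ℕ := ⟨fun p ↦ column p (ν p), fun _ _ h ↦ (Nat.pair_eq_pair.1 h).1⟩
  refine ⟨m, .inr fun p G hG ↦ ?_⟩
  have hpG : m p ∉ G.map m := by rwa [Finset.mem_map']
  have hpF : m p ∉ (F p).map (column p) := by
    change column p (ν p) ∉ _
    rw [Finset.mem_map']
    exact hνF p
  have hdisj : Disjoint (G.map m) ((F p).map (column p)) := by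
    rw [Finset.disjoint_left]
    simp only [Finset.mem_map]
    rintro _ ⟨q, hq, rfl⟩ ⟨i, -, hqi⟩
    exact hG ((Nat.pair_eq_pair.1 hqi).1 ▸ hq)
  have hsum := hμ (m p) (G.map m ∪ (F p).map (column p))
    (Finset.notMem_union.2 ⟨hpG, hpF⟩)
  rw [Finset.sum_union hdisj, Finset.sum_map, Finset.sum_map] at hsum
  have hFp : ε < ∑ k ∈ F p, μ (m p) (column p k) := hF p
  linarith

theorem OffDiagSumLE.exists_embedding {C : ℝ} {μ : ℕ → ℕ → ℝ} (hμ : OffDiagSumLE C μ)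
    {ε : ℝ} (hε : 0 < ε) : ∃ m : ℕ ↪ ℕ, OffDiagSumLE ε fun n k ↦ μ (m n) (m k) := by
  obtain ⟨j, hj⟩ := Archimedean.arch C hε
  induction j generalizing C μ with
  | zero =>
    refine ⟨.refl ℕ, fun n F hF ↦ (hμ n F hF).trans (hj.trans ?_)⟩
    rw [zero_nsmul]
    exact hε.le
  | succ j ih =>
    obtain ⟨m, hm | hm⟩ := hμ.exists_embedding_or_sub ε
    · exact ⟨m, hm⟩
    · obtain ⟨l, hl⟩ := ih hm (sub_le_iff_le_add.2 (by rwa [succ_nsmul] at hj))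
      exact ⟨l.trans m, hl⟩

end Disjointification

section WeaklyUnconditionallyCauchy

variable {ι κ Z W : Type*} [SeminormedAddCommGroup Z] [NormedSpace ℝ Z]
  [SeminormedAddCommGroup W] [NormedSpace ℝ W] {C : ℝ≥0} {z : ι → Z}

/-- The series `∑ z k` is weakly unconditionally Cauchy, with constant `C`: the series `∑ |φ (z k)|`
converges to a value at most `C * ‖φ‖` for every functional `φ`. -/
def IsWUCWith (C : ℝ≥0) (z : ι → Z) : Prop :=
  ∀ (φ : StrongDual ℝ Z) (F : Finset ι), ∑ k ∈ F, |φ (z k)| ≤ C * ‖φ‖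

theorem IsWUCWith.map (hz : IsWUCWith C z) (T : Z →L[ℝ] W) :
    IsWUCWith (C * ‖T‖₊) fun k ↦ T (z k) := fun φ F ↦
  calc ∑ k ∈ F, |φ (T (z k))| ≤ C * ‖φ ∘L T‖ := hz (φ ∘L T) F
    _ ≤ C * (‖φ‖ * ‖T‖) := by gcongr; exact φ.opNorm_comp_le T
    _ = ↑(C * ‖T‖₊) * ‖φ‖ := by rw [NNReal.coe_mul, coe_nnnorm]; ring

theorem IsWUCWith.comp_embedding (hz : IsWUCWith C z) (m : κ ↪ ι) : IsWUCWith C (z ∘ m) :=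
  fun φ F ↦ by simpa only [Finset.sum_map, Function.comp_apply] using hz φ (F.map m)

theorem IsWUCWith.norm_sum_smul_le (hz : IsWUCWith C z) {a : ι → ℝ} {F : Finset ι} {M : ℝ}
    (hM : 0 ≤ M) (ha : ∀ k ∈ F, |a k| ≤ M) : ‖∑ k ∈ F, a k • z k‖ ≤ C * M := by
  obtain ⟨φ, hφ, hφz⟩ := exists_dual_vector'' ℝ (∑ k ∈ F, a k • z k)
  calc ‖∑ k ∈ F, a k • z k‖ = ∑ k ∈ F, a k * φ (z k) := by
        simpa only [map_sum, map_smul, smul_eq_mul, RCLike.ofReal_real_eq_id, id] using hφz.symm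
    _ ≤ ∑ k ∈ F, M * |φ (z k)| := by
        refine Finset.sum_le_sum fun k hk ↦ (le_abs_self _).trans ?_
        rw [abs_mul]
        gcongr
        exact ha k hk
    _ = M * ∑ k ∈ F, |φ (z k)| := by rw [Finset.mul_sum]
    _ ≤ M * (C * 1) := by gcongr; exact (hz φ F).trans (by gcongr)
    _ = C * M := by ring

theorem IsWUCWith.summable_smul [CompleteSpace Z] (hz : IsWUCWith C z) {a : ι → ℝ}
    (ha : Tendsto a cofinite (𝓝 0)) : Summable fun k ↦ a k • z k := by
  refine summable_iff_vanishing_norm.2 fun ε hε ↦ ?_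
  have hsmall : ∀ᶠ k in cofinite, dist (a k) 0 < ε / (C + 1) :=
    Metric.tendsto_nhds.1 ha _ (by positivity)
  refine ⟨(eventually_cofinite.1 hsmall).toFinset, fun F hF ↦ ?_⟩
  calc ‖∑ k ∈ F, a k • z k‖ ≤ C * (ε / (C + 1)) := by
        refine hz.norm_sum_smul_le (by positivity) fun k hk ↦ ?_
        exact le_of_lt (by simpa using Finset.disjoint_left.1 hF hk)
    _ < (C + 1) * (ε / (C + 1)) := by gcongr; linarith
    _ = ε := mul_div_cancel₀ _ (by positivity)

end WeaklyUnconditionallyCauchy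

section ZeroAtInfty

variable {α Z : Type*} [TopologicalSpace α] [NormedAddCommGroup Z] [NormedSpace ℝ Z] {C : ℝ≥0}
  {z : α → Z}

theorem abs_zeroAtInfty_apply_le (a : C₀(α, ℝ)) (k : α) : |a k| ≤ ‖a‖ := by
  rw [← ZeroAtInftyContinuousMap.norm_toBCF_eq_norm]
  exact a.toBCF.norm_coe_le_norm k

theorem norm_zeroAtInfty_le {a : C₀(α, ℝ)} {M : ℝ} (hM : 0 ≤ M) (h : ∀ k, |a k| ≤ M) :
    ‖a‖ ≤ M := by
  rw [← ZeroAtInftyContinuousMap.norm_toBCF_eq_norm]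
  exact (BoundedContinuousFunction.norm_le hM).2 h

theorem IsWUCWith.exists_hasSum_smul [DiscreteTopology α] [CompleteSpace Z]
    (hz : IsWUCWith C z) :
    ∃ S : C₀(α, ℝ) →L[ℝ] Z, ∀ a : C₀(α, ℝ), HasSum (fun k ↦ a k • z k) (S a) := by
  have hsum (a : C₀(α, ℝ)) : Summable fun k ↦ a k • z k := by
    refine hz.summable_smul ?_
    rw [← cocompact_eq_cofinite]
    exact a.zero_at_infty'
  let S : C₀(α, ℝ) →ₗ[ℝ] Z :=
    { toFun a := ∑' k, a k • z k
      map_add' a b := by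
        simp only [ZeroAtInftyContinuousMap.coe_add, Pi.add_apply, add_smul,
          (hsum a).tsum_add (hsum b)]
      map_smul' c a := by
        simp only [ZeroAtInftyContinuousMap.coe_smul, Pi.smul_apply, smul_assoc, RingHom.id_apply,
          (hsum a).tsum_const_smul] }
  refine ⟨S.mkContinuous C fun a ↦ ?_, fun a ↦ (hsum a).hasSum⟩
  exact le_of_tendsto (hsum a).hasSum.norm (.of_forall fun F ↦
    hz.norm_sum_smul_le (norm_nonneg a) fun k _ ↦ abs_zeroAtInfty_apply_le a k)

end ZeroAtInfty

section BessagaPelczynski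

variable {ι Z : Type*} [NormedAddCommGroup Z] [NormedSpace ℝ Z]

theorem abs_mul_abs_apply_le_of_hasSum {z : ι → Z} {a : ι → ℝ} {M : ℝ} (ha : ∀ k, |a k| ≤ M)
    {x : Z} (hx : HasSum (fun k ↦ a k • z k) x) {φ : StrongDual ℝ Z} (hφ : ‖φ‖ ≤ 1) {n : ι} {η : ℝ}
    (hη : ∀ F : Finset ι, n ∉ F → ∑ k ∈ F, |φ (z k)| ≤ η) :
    |a n| * |φ (z n)| ≤ ‖x‖ + η * M := by
  classical
  have hM : 0 ≤ M := (abs_nonneg _).trans (ha n)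
  have hφx : HasSum (fun k ↦ a k * φ (z k)) (φ x) := by simpa using φ.hasSum hx
  have hoff : |φ x - a n * φ (z n)| ≤ η * M := by
    refine le_of_tendsto (hasSum_ite_sub_hasSum hφx n).abs (.of_forall fun F ↦ ?_)
    calc |∑ k ∈ F, if k = n then 0 else a k * φ (z k)|
        = |∑ k ∈ F.erase n, a k * φ (z k)| := by
          simp only [Finset.sum_ite, Finset.sum_const_zero, zero_add, Finset.filter_ne']
      _ ≤ ∑ k ∈ F.erase n, |φ (z k)| * M := by
          refine (Finset.abs_sum_le_sum_abs _ _).trans (Finset.sum_le_sum fun k _ ↦ ?_)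
          rw [abs_mul, mul_comm]
          gcongr
          exact ha k
      _ ≤ η * M := by
          rw [← Finset.sum_mul]
          gcongr
          exact hη _ (Finset.notMem_erase n F)
  calc |a n| * |φ (z n)| = |φ x - (φ x - a n * φ (z n))| := by rw [sub_sub_cancel, abs_mul]
    _ ≤ |φ x| + |φ x - a n * φ (z n)| := abs_sub _ _
    _ ≤ ‖x‖ + η * M := add_le_add (φ.le_of_opNorm_le hφ x |>.trans_eq (one_mul _)) hoff

theorem containsCopyOfCZero_of_forall_norm_le [CompleteSpace Z] (S : C₀(ℕ, ℝ) →L[ℝ] Z) {K : ℝ≥0}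
    (hS : ∀ a, ‖a‖ ≤ K * ‖S a‖) : ContainsCopyOfCZero Z := by
  have hanti : AntilipschitzWith K S := S.antilipschitz_of_bound hS
  exact ⟨_, ⟨S.equivRange hanti.injective (hanti.isClosed_range S.uniformContinuous)⟩⟩

theorem IsWUCWith.containsCopyOfCZero [CompleteSpace Z] {z : ℕ → Z} {C : ℝ≥0}
    (hz : IsWUCWith C z) {δ : ℝ≥0} (hδ : 0 < δ) (hzδ : ∀ n, δ ≤ ‖z n‖) :
    ContainsCopyOfCZero Z := by
  choose φ hφ hφz using fun n ↦ exists_dual_vector'' ℝ (z n)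
  have hdiag : OffDiagSumLE C fun n k ↦ |φ n (z k)| := fun n F _ ↦
    (hz (φ n) F).trans (mul_le_of_le_one_right C.2 (hφ n))
  obtain ⟨m, hm⟩ := hdiag.exists_embedding (ε := δ / 2) (by positivity)
  obtain ⟨S, hS⟩ := (hz.comp_embedding m).exists_hasSum_smul
  refine containsCopyOfCZero_of_forall_norm_le S (K := 2 / δ) fun a ↦ ?_
  have hcoord (n) : |a n| ≤ (‖S a‖ + δ / 2 * ‖a‖) / δ := by
    rw [le_div_iff₀ (by positivity)]
    calc |a n| * δ ≤ |a n| * |φ (m n) (z (m n))| := by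
          gcongr
          rw [hφz]
          exact (hzδ (m n)).trans (le_abs_self _)
      _ ≤ ‖S a‖ + δ / 2 * ‖a‖ :=
          abs_mul_abs_apply_le_of_hasSum (abs_zeroAtInfty_apply_le a) (hS a) (hφ (m n)) (hm n)
  have hnorm := norm_zeroAtInfty_le (by positivity) hcoord
  rw [le_div_iff₀ (by positivity)] at hnorm
  rw [NNReal.coe_div, div_mul_eq_mul_div, le_div_iff₀ (by positivity), NNReal.coe_ofNat]
  linarith

end BessagaPelczynski

section FiniteDimensional

theorem not_finiteDimensional_zeroAtInfty (α : Type*) [TopologicalSpace α] [DiscreteTopology α]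
    [Infinite α] : ¬ FiniteDimensional ℝ C₀(α, ℝ) := by
  classical
  intro _
  let u (n : α) : C₀(α, ℝ) :=
    { toFun := Pi.single n 1
      continuous_toFun := continuous_of_discreteTopology
      zero_at_infty' := by
        rw [cocompact_eq_cofinite]
        refine tendsto_const_nhds.congr' ?_
        filter_upwards [(Set.finite_singleton n).compl_mem_cofinite] with k hk
        exact (Pi.single_eq_of_ne (M := fun _ ↦ ℝ) hk 1).symm }
  let coe : C₀(α, ℝ) →ₗ[ℝ] α → ℝ :=
    { toFun := fun a ↦ a, map_add' := fun _ _ ↦ rfl, map_smul' := fun _ _ ↦ rfl }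
  have hu : LinearIndependent ℝ u := .of_comp coe (Pi.linearIndependent_single_one α ℝ)
  exact not_finite_iff_infinite.2 ‹_› hu.finite

theorem not_containsCopyOfCZero_of_finiteDimensional (Z : Type*) [SeminormedAddCommGroup Z]
    [NormedSpace ℝ Z] [FiniteDimensional ℝ Z] : ¬ ContainsCopyOfCZero Z := by
  rintro ⟨W, ⟨e⟩⟩
  exact not_finiteDimensional_zeroAtInfty ℕ e.toLinearEquiv.symm.finiteDimensional

end FiniteDimensional

section SignedSums

variable {A Y : Type*} [AddCommGroup A] [DecidableEq A] [SeminormedAddCommGroup Y] [DecidableEq Y]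

/-- The set of the vectors `±y 0 ± ⋯ ± y (n - 1)`, as a pointwise sum of two-point sets. If these
sets are uniformly bounded, then the series `∑ y k` is weakly unconditionally Cauchy. -/
def signedSums (y : ℕ → A) (n : ℕ) : Finset A :=
  ∑ k ∈ Finset.range n, {y k, -y k}

theorem signedSums_succ (y : ℕ → A) (n : ℕ) :
    signedSums y (n + 1) = signedSums y n + {y n, -y n} :=
  Finset.sum_range_succ ..

theorem exists_seq_forall_signedSums {P : ℕ → Finset A → A → Prop} (h : ∀ n V, ∃ y, P n V y) :
    ∃ y : ℕ → A, ∀ n, P n (signedSums y n) (y n) := by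
  choose g hg using h
  let V (n : ℕ) : Finset A := Nat.rec 0 (fun n V ↦ V + {g n V, -g n V}) n
  have hV (n : ℕ) : signedSums (fun k ↦ g k (V k)) n = V n := by
    induction n with
    | zero => rfl
    | succ n ih => rw [signedSums_succ, ih]
  exact ⟨fun n ↦ g n (V n), fun n ↦ by rw [hV]; exact hg n (V n)⟩

theorem exists_mem_signedSums_apply_eq (y : ℕ → A) (φ : A →+ ℝ) (n : ℕ) :
    ∃ v ∈ signedSums y n, φ v = ∑ k ∈ Finset.range n, |φ (y k)| := by
  induction n with
  | zero => exact ⟨0, Finset.zero_mem_zero, by simp⟩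
  | succ n ih =>
    obtain ⟨v, hv, hφv⟩ := ih
    obtain ⟨w, hw, hφw⟩ : ∃ w ∈ ({y n, -y n} : Finset A), φ w = |φ (y n)| := by
      rcases abs_choice (φ (y n)) with h | h
      · exact ⟨y n, by simp, h.symm⟩
      · exact ⟨-y n, by simp, by rw [map_neg, h]⟩
    rw [signedSums_succ, Finset.sum_range_succ]
    exact ⟨v + w, Finset.add_mem_add hv hw, by rw [map_add, hφv, hφw]⟩

theorem norm_le_prod_of_mem_signedSums {y : ℕ → Y} {η : ℕ → ℝ} (hη : ∀ n, 0 ≤ η n)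
    (hy : ∀ n, ∀ v ∈ signedSums y n, ‖v + y n‖ ≤ (1 + η n) * max ‖v‖ 1 ∧
      ‖v - y n‖ ≤ (1 + η n) * max ‖v‖ 1) (n : ℕ) :
    ∀ v ∈ signedSums y n, ‖v‖ ≤ ∏ k ∈ Finset.range n, (1 + η k) := by
  induction n with
  | zero =>
    intro v hv
    simp [Finset.mem_zero.1 hv]
  | succ n ih =>
    intro x hx
    rw [signedSums_succ] at hx
    obtain ⟨v, hv, w, hw, rfl⟩ := Finset.mem_add.1 hx
    have hmax : max ‖v‖ 1 ≤ ∏ k ∈ Finset.range n, (1 + η k) :=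
      max_le (ih v hv) (Finset.one_le_prod fun k _ ↦ le_add_of_nonneg_right (hη k))
    have hvw : ‖v + w‖ ≤ (1 + η n) * max ‖v‖ 1 := by
      obtain rfl | rfl : w = y n ∨ w = -y n := by simpa using hw
      · exact (hy n v hv).1
      · simpa only [sub_eq_add_neg] using (hy n v hv).2
    rw [Finset.prod_range_succ, mul_comm]
    exact hvw.trans (mul_le_mul_of_nonneg_left hmax (by linarith [hη n]))

variable [NormedSpace ℝ Y]

theorem isWUCWith_of_norm_signedSums_le {y : ℕ → Y} {C : ℝ≥0}
    (h : ∀ n, ∀ v ∈ signedSums y n, ‖v‖ ≤ C) : IsWUCWith C y := by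
  intro φ F
  obtain ⟨n, hFn⟩ := F.exists_nat_subset_range
  obtain ⟨v, hv, hφv⟩ := exists_mem_signedSums_apply_eq y (φ : Y →+ ℝ) n
  calc ∑ k ∈ F, |φ (y k)| ≤ ∑ k ∈ Finset.range n, |φ (y k)| :=
        Finset.sum_le_sum_of_subset_of_nonneg hFn fun _ _ _ ↦ abs_nonneg _
    _ = φ v := hφv.symm
    _ ≤ ‖φ‖ * ‖v‖ := (le_abs_self _).trans (φ.le_opNorm v)
    _ ≤ ‖φ‖ * C := by gcongr; exact h n v hv
    _ = C * ‖φ‖ := mul_comm _ _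

theorem isWUCWith_of_norm_add_sub_le {y : ℕ → Y}
    (hy : ∀ n, ∀ v ∈ signedSums y n, ‖v + y n‖ ≤ (1 + (1 / 2) ^ n) * max ‖v‖ 1 ∧
      ‖v - y n‖ ≤ (1 + (1 / 2) ^ n) * max ‖v‖ 1) : IsWUCWith (Real.exp 2).toNNReal y := by
  refine isWUCWith_of_norm_signedSums_le fun n v hv ↦ ?_
  calc ‖v‖ ≤ ∏ k ∈ Finset.range n, (1 + (1 / 2 : ℝ) ^ k) :=
        norm_le_prod_of_mem_signedSums (fun _ ↦ by positivity) hy n v hv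
    _ ≤ Real.exp (∑ k ∈ Finset.range n, (1 / 2 : ℝ) ^ k) :=
        Real.prod_one_add_le_exp_sum _ fun _ ↦ by positivity
    _ ≤ Real.exp 2 := by gcongr; exact sum_geometric_two_le n
    _ = (Real.exp 2).toNNReal := (Real.coe_toNNReal _ (Real.exp_nonneg 2)).symm

end SignedSums

section AlmostSquareSequences

theorem norm_smul_add_smul_le_mul_max {Y : Type*} [SeminormedAddCommGroup Y] [NormedSpace ℝ Y]
    {v y : Y} {M a b : ℝ} (hv : ‖v‖ ≤ M) (hy : ‖y‖ ≤ M) (hvy : ‖v + y‖ ≤ M) (ha : 0 ≤ a)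
    (hb : 0 ≤ b) : ‖a • v + b • y‖ ≤ M * max a b := by
  wlog hab : a ≤ b generalizing a b v y
  · rw [add_comm, max_comm]
    exact this hy hv (by rwa [add_comm]) hb ha (le_of_not_ge hab)
  have hba : 0 ≤ b - a := sub_nonneg.2 hab
  calc ‖a • v + b • y‖ = ‖a • (v + y) + (b - a) • y‖ := by congr 1; module
    _ ≤ ‖a • (v + y)‖ + ‖(b - a) • y‖ := norm_add_le _ _
    _ = a * ‖v + y‖ + (b - a) * ‖y‖ := by
        rw [norm_smul_of_nonneg ha, norm_smul_of_nonneg hba]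
    _ ≤ a * M + (b - a) * M := by gcongr
    _ = M * max a b := by rw [max_eq_right hab]; ring

variable {Y : Type*} [NormedAddCommGroup Y] [NormedSpace ℝ Y]

theorem IsAlmostSquare.exists_norm_sub_le_mul_max (hY : IsAlmostSquare Y) {ε : ℝ} (hε : 0 < ε)
    (V : Finset Y) : ∃ y : Y, ‖y‖ = 1 ∧ ∀ v ∈ V, ‖v - y‖ ≤ (1 + ε) * max ‖v‖ 1 := by
  classical
  obtain ⟨y, hy, hVy⟩ := hY ε hε ((V.erase 0).image NormedSpace.normalize) fun x hx ↦ by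
    obtain ⟨v, hv, rfl⟩ := Finset.mem_image.1 hx
    exact NormedSpace.norm_normalize_eq_one_iff.2 (Finset.ne_of_mem_erase hv)
  refine ⟨y, hy, fun v hv ↦ ?_⟩
  rcases eq_or_ne v 0 with rfl | hv0
  · simp [hy, hε.le]
  have hnorm : ‖NormedSpace.normalize v‖ = 1 := NormedSpace.norm_normalize_eq_one_iff.2 hv0
  have hvy := hVy _ (Finset.mem_image_of_mem _ (Finset.mem_erase.2 ⟨hv0, hv⟩))
  rw [sub_eq_add_neg] at hvy
  have hmax := norm_smul_add_smul_le_mul_max (by linarith : ‖NormedSpace.normalize v‖ ≤ 1 + ε)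
    (by rw [norm_neg]; linarith) hvy (norm_nonneg v) zero_le_one
  rwa [NormedSpace.norm_smul_normalize, one_smul, ← sub_eq_add_neg] at hmax

theorem IsAlmostSquare.exists_norm_add_sub_le_mul_max (hY : IsAlmostSquare Y) {ε : ℝ}
    (hε : 0 < ε) (V : Finset Y) :
    ∃ y : Y, ‖y‖ = 1 ∧ ∀ v ∈ V, ‖v + y‖ ≤ (1 + ε) * max ‖v‖ 1 ∧
      ‖v - y‖ ≤ (1 + ε) * max ‖v‖ 1 := by
  classical
  obtain ⟨y, hy, hVy⟩ := hY.exists_norm_sub_le_mul_max hε (V ∪ -V)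
  refine ⟨y, hy, fun v hv ↦ ⟨?_, hVy v (Finset.mem_union_left _ hv)⟩⟩
  have hneg := hVy (-v) (Finset.mem_union_right _ (Finset.neg_mem_neg hv))
  rwa [← neg_add', norm_neg, norm_neg] at hneg

theorem IsAlmostSquare.exists_seq_isWUCWith (hY : IsAlmostSquare Y) {ε : ℝ} (hε : 0 < ε)
    {s : Finset Y} (hs : ∀ x ∈ s, ‖x‖ = 1) :
    ∃ (C : ℝ≥0) (y : ℕ → Y), IsWUCWith C y ∧ ∀ n, ‖y n‖ = 1 ∧ ∀ x ∈ s, ‖x - y n‖ ≤ 1 + ε := by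
  classical
  obtain ⟨y, hy⟩ := exists_seq_forall_signedSums fun (n : ℕ) V ↦
    hY.exists_norm_add_sub_le_mul_max (ε := min ε ((1 / 2) ^ n)) (by positivity) (s ∪ V)
  have hle (n : ℕ) (v : Y) :
      (1 + min ε ((1 / 2) ^ n)) * max ‖v‖ 1 ≤ (1 + (1 / 2) ^ n) * max ‖v‖ 1 := by
    gcongr
    exact min_le_right _ _
  refine ⟨_, y, isWUCWith_of_norm_add_sub_le fun n v hv ↦ ?_, fun n ↦ ⟨(hy n).1, fun x hx ↦ ?_⟩⟩
  · obtain ⟨hadd, hsub⟩ := (hy n).2 v (Finset.mem_union_right _ hv)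
    exact ⟨hadd.trans (hle n v), hsub.trans (hle n v)⟩
  · calc ‖x - y n‖ ≤ (1 + min ε ((1 / 2) ^ n)) * max ‖x‖ 1 :=
          ((hy n).2 x (Finset.mem_union_left _ hx)).2
      _ ≤ 1 + ε := by
          rw [hs x hx, max_self, mul_one]
          gcongr
          exact min_le_left _ _

theorem IsAlmostSquare.of_not_containsCopyOfCZero_quotient [CompleteSpace Y]
    (hY : IsAlmostSquare Y) {X : Submodule ℝ Y} [IsClosed (X : Set Y)]
    (hc : ¬ ContainsCopyOfCZero (Y ⧸ X)) : IsAlmostSquare X := by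
  classical
  refine .of_forall_exists_abs_norm_sub_one_le fun ε hε s hs ↦ ?_
  obtain ⟨C, y, hwuc, hy⟩ := hY.exists_seq_isWUCWith (half_pos hε) (s := s.image (↑))
    (by simpa using hs)
  obtain ⟨n, hn⟩ : ∃ n, ‖X.mkQL (y n)‖ < ε / 2 := by
    by_contra! h
    lift ε to ℝ≥0 using hε.le
    exact hc ((hwuc.map X.mkQL).containsCopyOfCZero (δ := ε / 2) (half_pos hε) h)
  obtain ⟨x₀, hx₀, hlt⟩ : ∃ x₀ ∈ X, ‖y n - x₀‖ < ε / 2 := by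
    have hdist : Metric.infDist (y n) X < ε / 2 :=
      (QuotientAddGroup.norm_mk (S := X.toAddSubgroup) (y n)).symm.trans_lt hn
    simpa only [dist_eq_norm, SetLike.mem_coe] using (Metric.infDist_lt_iff X.nonempty).1 hdist
  refine ⟨⟨x₀, hx₀⟩, ?_, fun x hx ↦ ?_⟩
  · calc |‖x₀‖ - 1| = |‖x₀‖ - ‖y n‖| := by rw [(hy n).1]
      _ ≤ ‖x₀ - y n‖ := abs_norm_sub_norm_le _ _
      _ ≤ ε := by rw [norm_sub_rev]; linarith
  · calc ‖(x : Y) - x₀‖ ≤ ‖(x : Y) - y n‖ + ‖y n - x₀‖ := norm_sub_le_norm_sub_add_norm_sub ..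
      _ ≤ (1 + ε / 2) + ε / 2 := add_le_add ((hy n).2 x (Finset.mem_image_of_mem _ hx)) hlt.le
      _ = 1 + ε := by ring

end AlmostSquareSequences

theorem mainTheorem4 (Y : Type*) [NormedAddCommGroup Y] [NormedSpace ℝ Y] [CompleteSpace Y] :
    List.TFAE [
      IsAlmostSquare Y,
      ∀ X : Submodule ℝ Y, IsClosed (X : Set Y) → TopologicalSpace.SeparableSpace X →
        IsAIIdeal X → IsAlmostSquare X,
      ∀ X : Submodule ℝ Y, IsClosed (X : Set Y) → ¬ ContainsCopyOfCZero (Y ⧸ X) →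
        IsAlmostSquare X,
      ∀ X : Submodule ℝ Y, IsClosed (X : Set Y) → FiniteDimensional ℝ (Y ⧸ X) →
        IsAlmostSquare X] := by
  tfae_have 1 → 2 := fun h X _ _ hX ↦ h.of_isAIIdeal hX
  tfae_have 2 → 1 := fun h ↦ .of_forall_finset_subset_submodule fun s ↦ by
    obtain ⟨X, hsX, hcl, hsep, hX⟩ :=
      exists_isSeparable_isAIIdeal (.span ℝ (s : Set Y)) s.finite_toSet.isSeparable.span
    exact ⟨X, Submodule.span_le.1 hsX, h X hcl hsep.separableSpace hX⟩
  tfae_have 1 → 3 := fun h X _ hc ↦ h.of_not_containsCopyOfCZero_quotient hc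
  tfae_have 3 → 4 := fun h X hX _ ↦
    h X hX (not_containsCopyOfCZero_of_finiteDimensional (Y ⧸ X))
  tfae_have 4 → 1 := fun h ↦ .of_forall_finset_subset_submodule fun s ↦
    ⟨⊤, fun _ _ ↦ Submodule.mem_top, h ⊤ isClosed_univ inferInstance⟩
  tfae_finish
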